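/- Let $\Phi_1$ (macro base stations) and $\Phi_2$ (small cell base stations) be independent homogeneous Poisson point processes on $\mathbb R^2$ with densities $\lambda_1,\lambda_2>0$. Stations of tier $k\in\{1,2\}$ transmit with power $P_k>0$, and a user at distance $r$ from such a station receives (mean) power $P_k r^{-\alpha}$, where $\alpha>2$. Let $r_c\ge 0$ be the charging range of the small cell stations, $\hat r_a\ge 0$ the maximum distance that a user is willing to move, and $r_s=r_c+\hat r_a$. Consider a user at a fixed location (for instance the origin), whose residual battery level is in $\{0,1,2,3\}$; it is a high-battery user if the level is $2$ or $3$, and a low-battery (battery-depleting) user if the level is $1$. A user of level $0$ or $1$ is attracted if the distance it would have to move straight towards its nearest small cell station in order to be within distance $r_c$ of it is at most $\hat r_a$; users of level $2$ or $3$ are never attracted. An attracted user associates with a small cell station (tier $2$); every other user associates with the station from which it receives the largest power. Then, for $k\in\{1,2\}$, the probability $\mathcal A_k^h$ that a high-battery user associates with tier $k$ and the probability $\mathcal A_k^\ell$ that a low-battery user associates with tier $k$ are $$\mathcal A_k^h=\Big[\lambda_k^{-1}\sum_{i=1}^2\lambda_i\Big(\frac{P_i}{P_k}\Big)^{2/\alpha}\Big]^{-1},$$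 $$\mathcal A_k^\ell=(-1)^k\Big(\mathcal A_2^h\, e^{-\pi\frac{\lambda_2}{\mathcal A_2^h}r_s^2}-e^{-\pi\lambda_2 r_s^2}\Big)+(k-1).$$ -/

import Mathlib

open MeasureTheory ProbabilityTheory
open scoped ENNReal NNReal

/-- The plane `ℝ²` with its Euclidean norm. -/
abbrev Plane : Type := EuclideanSpace ℝ (Fin 2)

/-- A bounded Borel subset of the plane. -/
abbrev BoundedBorel : Type := {B : Set Plane // MeasurableSet B ∧ Bornology.IsBounded B}

/-- The number of points of the random set `Φ` in `B`. -/
noncomputable def pointCount {Ω : Type*} (Φ : Ω → Set Plane) (B : Set Plane) (ω : Ω) : ℕ :=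
  (Φ ω ∩ B).ncard

/-- `Φ` is a homogeneous Poisson point process on the plane with density `lam`, given as a random
locally finite set of points. -/
structure IsHPPP {Ω : Type*} [MeasurableSpace Ω] (μ : Measure Ω) (lam : ℝ)
    (Φ : Ω → Set Plane) : Prop where
  /-- every bounded region contains finitely many points -/
  locallyFinite : ∀ (ω : Ω) (B : Set Plane), Bornology.IsBounded B → (Φ ω ∩ B).Finite
  /-- counts in bounded Borel sets are random variables -/
  measurable_count : ∀ B : BoundedBorel, Measurable (pointCount Φ B.1)
  /-- the count in `B` is Poisson with mean `lam * area B` -/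
  law_count : ∀ B : BoundedBorel,
    μ.map (pointCount Φ B.1) = poissonMeasure (lam * volume.real B.1).toNNReal
  /-- counts in pairwise disjoint bounded Borel sets are independent -/
  indep_count : ∀ (n : ℕ) (B : Fin n → BoundedBorel),
    Pairwise (fun i j => Disjoint (B i).1 (B j).1) →
      iIndepFun (fun i => pointCount Φ (B i).1) μ

/-- Two point processes are independent: their whole families of counts are. -/
def IndepPointProcesses {Ω : Type*} [MeasurableSpace Ω] (μ : Measure Ω)
    (Φ Ψ : Ω → Set Plane) : Prop :=
  IndepFun (fun ω (B : BoundedBorel) => pointCount Φ B.1 ω)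
    (fun ω (B : BoundedBorel) => pointCount Ψ B.1 ω) μ

/-- The tier number `1` (macro cells, index `0`) or `2` (small cells, index `1`). -/
def tierNumber (k : Fin 2) : ℕ := k.val + 1

/-- Mean power received at `u` from a station at `x` transmitting with power `p`, under path loss
with exponent `α` (infinite if the station is at `u`). -/
noncomputable def receivedPower (α p : ℝ) (u x : Plane) : ℝ≥0∞ :=
  ENNReal.ofReal p * edist u x ^ (-α)

/-- Among all base stations `S 0 ∪ S 1`, where those of tier `j` transmit with power `P j`, one of
tier `k` gives the strongest received power at `u`. -/
def StrongestFrom (P : Fin 2 → ℝ) (α : ℝ) (u : Plane) (S : Fin 2 → Set Plane) (k : Fin 2) : Prop :=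
  ∃ x ∈ S k, ∀ j, ∀ y ∈ S j, receivedPower α (P j) u y ≤ receivedPower α (P k) u x

/-- Residual battery energy, as the number `0, 1, 2, 3` of information receptions it allows. -/
abbrev BatteryLevel : Type := Fin 4

/-- High battery users: residual energy `2` or `3`. -/
def IsHighBattery (L : BatteryLevel) : Prop := L = 2 ∨ L = 3

/-- Low battery (battery depleting) users: residual energy `1`. -/
def IsLowBattery (L : BatteryLevel) : Prop := L = 1

/-- The distance a user at `u` has to move straight towards a small cell base station at `x` until
it is within the charging range `rc` (zero if it is already there). -/
noncomputable def attractionDistance (rc : ℝ) (u x : Plane) : ℝ := max (dist u x - rc) 0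

/-- A user at `u` with battery level `L` is spatially attracted: its battery level is `0` or `1`,
and the attraction distance to the nearest small cell base station is at most `raMax`. -/
def IsAttracted (rc raMax : ℝ) (L : BatteryLevel) (u : Plane) (small : Set Plane) : Prop :=
  (L = 0 ∨ L = 1) ∧
    ∃ x ∈ small, (∀ y ∈ small, dist u x ≤ dist u y) ∧ attractionDistance rc u x ≤ raMax

/-- The association rule: an attracted user associates with a small cell base station; every other
user associates with the base station giving the strongest received power. -/
def AssociatesWith (P : Fin 2 → ℝ) (α rc raMax : ℝ) (L : BatteryLevel) (u : Plane)
    (S : Fin 2 → Set Plane) (k : Fin 2) : Prop :=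
  (IsAttracted rc raMax L u (S 1) ∧ k = 1) ∨
    (¬ IsAttracted rc raMax L u (S 1) ∧ StrongestFrom P α u S k)

/-- The event that the user located at `u` with battery level `L` associates with tier `k`. -/
def associationEvent {Ω : Type*} (Φ : Fin 2 → Ω → Set Plane) (P : Fin 2 → ℝ) (α rc raMax : ℝ)
    (L : BatteryLevel) (u : Plane) (k : Fin 2) : Set Ω :=
  {ω | AssociatesWith P α rc raMax L u (fun j => Φ j ω) k}

/-- The closed form `[λₖ⁻¹ ∑ᵢ λᵢ (Pᵢ / Pₖ) ^ (2 / α)]⁻¹`. -/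
noncomputable def highFormula (lam P : Fin 2 → ℝ) (α : ℝ) (k : Fin 2) : ℝ :=
  ((lam k)⁻¹ * ∑ i, lam i * (P i / P k) ^ (2 / α))⁻¹

/-! Let $R_k$ be the distance from the user to the nearest tier-$k$ station. Void probabilities of
discs make $R_1^2, R_2^2$ independent exponentials with rates $\pi\lambda_k$
(`map_infDist_sq_prod`). Almost surely, tier $k$ is strongest iff $cR_k^2\le R_j^2$ with
$c=(P_j/P_k)^{2/\alpha}$ (`strongestFrom_iff_infDist`), and a low-battery user is attracted iff
$R_2\le r_s$ (`isAttracted_iff`).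

For independent exponentials $X,Y$ of rates $a,b$, integration over $X$ gives $P(X>s,\,cX\le
Y)=\frac{a}{a+bc}e^{-(a+bc)s}$ (`expMeasure_prod_apply`). Here $a/(a+bc)=\mathcal A_k^h$, so the
rate $a+bc$ is $\pi\lambda_k/\mathcal A_k^h$. Taking $s=0$ gives the high-battery formula; $s=r_s^2$
with $k=2$, combined with $P(R_2>r_s)$, gives the low-battery one. -/

/-! ### Comparison of two independent exponential variables -/

theorem expMeasure_eq_withDensity (b : ℝ) :
    expMeasure b = volume.withDensity (exponentialPDF b) := rfl

/-- Having no atoms makes ties in received power negligible, so weak and strict comparisons have the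
same probability. -/
instance nullSingletonClass_expMeasure (b : ℝ) : NullSingletonClass (expMeasure b) := by
  rw [expMeasure_eq_withDensity]
  infer_instance

theorem expMeasure_Iic {b x : ℝ} (hb : 0 < b) (hx : 0 ≤ x) :
    expMeasure b (Set.Iic x) = ENNReal.ofReal (1 - Real.exp (-(b * x))) := by
  have := isProbabilityMeasure_expMeasure hb
  rw [← ofReal_cdf, cdf_expMeasure_eq hb, if_pos hx]

theorem expMeasure_Ioi {b x : ℝ} (hb : 0 < b) (hx : 0 ≤ x) :
    expMeasure b (Set.Ioi x) = ENNReal.ofReal (Real.exp (-(b * x))) := by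
  have := isProbabilityMeasure_expMeasure hb
  rw [← Set.compl_Iic, prob_compl_eq_one_sub measurableSet_Iic, expMeasure_Iic hb hx,
    ← ENNReal.ofReal_one, ← ENNReal.ofReal_sub]
  · simp
  · simpa using mul_nonneg hb.le hx

/-- Integral of an exponential tail against the exponential law. -/
theorem setLIntegral_exp_expMeasure {a r s : ℝ} (ha : 0 < a) (hr : 0 ≤ r) (hs : 0 ≤ s) :
    ∫⁻ x in Set.Ioi s, ENNReal.ofReal (Real.exp (-(r * x))) ∂expMeasure a =
      ENNReal.ofReal (a / (a + r) * Real.exp (-((a + r) * s))) := by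
  have har : 0 < a + r := by linarith
  have hm : Measurable (exponentialPDF a) := by
    unfold exponentialPDF
    fun_prop
  rw [expMeasure_eq_withDensity, restrict_withDensity measurableSet_Ioi,
    lintegral_withDensity_eq_lintegral_mul _ hm (by fun_prop)]
  have h : ∀ x ∈ Set.Ioi s, (exponentialPDF a * fun x => ENNReal.ofReal (Real.exp (-(r * x)))) x =
      ENNReal.ofReal (a * Real.exp (-(a + r) * x)) := by
    intro x hx
    rw [Pi.mul_apply, exponentialPDF_of_nonneg (hs.trans (le_of_lt hx)),
      ← ENNReal.ofReal_mul (by positivity), mul_assoc, ← Real.exp_add]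
    ring_nf
  rw [setLIntegral_congr_fun measurableSet_Ioi h, ← ofReal_integral_eq_lintegral_ofReal]
  · rw [integral_const_mul, integral_exp_mul_Ioi (by linarith)]
    congr 1
    rw [neg_div_neg_eq, neg_mul]
    ring
  · exact (integrableOn_exp_mul_Ioi (by linarith) s).const_mul a
  · exact Filter.Eventually.of_forall fun x => by positivity

/-- For independent exponential variables `X` and `Y` of rates `a` and `b`, the probability of an
event which, given `X = x`, agrees almost surely with `s < x ∧ c * x < Y`. -/
theorem expMeasure_prod_apply {a b c s : ℝ} (ha : 0 < a) (hb : 0 < b) (hc : 0 ≤ c) (hs : 0 ≤ s)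
    {S : Set (ℝ × ℝ)} (hS : MeasurableSet S)
    (hpos : ∀ x, s < x → expMeasure b (Prod.mk x ⁻¹' S) = expMeasure b (Set.Ioi (c * x)))
    (hneg : ∀ x, x ≤ s → Prod.mk x ⁻¹' S = ∅) :
    (expMeasure a).prod (expMeasure b) S =
      ENNReal.ofReal (a / (a + b * c) * Real.exp (-((a + b * c) * s))) := by
  have := isProbabilityMeasure_expMeasure hb
  rw [Measure.prod_apply hS, ← setLIntegral_exp_expMeasure ha (mul_nonneg hb.le hc) hs,
    ← lintegral_indicator measurableSet_Ioi]
  refine lintegral_congr fun x => ?_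
  by_cases hx : s < x
  · rw [Set.indicator_of_mem (Set.mem_Ioi.2 hx), hpos x hx,
      expMeasure_Ioi hb (mul_nonneg hc (hs.trans hx.le)), mul_assoc]
  · rw [Set.indicator_of_notMem (by simpa using hx), hneg x (not_lt.1 hx), measure_empty]

theorem expMeasure_prod_le {a b c s : ℝ} (ha : 0 < a) (hb : 0 < b) (hc : 0 ≤ c) (hs : 0 ≤ s) :
    (expMeasure a).prod (expMeasure b) {p | s < p.1 ∧ c * p.1 ≤ p.2} =
      ENNReal.ofReal (a / (a + b * c) * Real.exp (-((a + b * c) * s))) := by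
  refine expMeasure_prod_apply ha hb hc hs ?_ (fun x hx => ?_) fun x hx => ?_
  · exact (measurableSet_lt measurable_const measurable_fst).inter
      (measurableSet_le (measurable_fst.const_mul c) measurable_snd)
  · rw [measure_congr Ioi_ae_eq_Ici]
    congr 1
    ext y
    simp [hx]
  · ext y
    simp [hx]

theorem expMeasure_prod_lt {a b c s : ℝ} (ha : 0 < a) (hb : 0 < b) (hc : 0 ≤ c) (hs : 0 ≤ s) :
    (expMeasure a).prod (expMeasure b) {p | s < p.1 ∧ c * p.1 < p.2} =
      ENNReal.ofReal (a / (a + b * c) * Real.exp (-((a + b * c) * s))) := by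
  refine expMeasure_prod_apply ha hb hc hs ?_ (fun x hx => ?_) fun x hx => ?_
  · exact (measurableSet_lt measurable_const measurable_fst).inter
      (measurableSet_lt (measurable_fst.const_mul c) measurable_snd)
  · congr 1
    ext y
    simp [hx]
  · ext y
    simp [hx]

/-! ### Law of the distance to the nearest station -/

theorem exists_infEDist_eq_edist {S : Set Plane}
    (hS : ∀ B, Bornology.IsBounded B → (S ∩ B).Finite) (hne : S.Nonempty) (u : Plane) :
    ∃ x ∈ S, Metric.infEDist u S = edist u x := by
  obtain ⟨y, hy⟩ := hne
  obtain ⟨x, ⟨hxS, hxB⟩, hx⟩ := Set.exists_min_image (S ∩ Metric.closedBall u (dist y u))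
    (fun z => edist u z) (hS _ Metric.isBounded_closedBall) ⟨y, hy, Metric.mem_closedBall.2 le_rfl⟩
  refine ⟨x, hxS, le_antisymm (Metric.infEDist_le_edist_of_mem hxS) ?_⟩
  refine Metric.le_infEDist.2 fun z hz => ?_
  by_cases hzB : z ∈ Metric.closedBall u (dist y u)
  · exact hx z ⟨hz, hzB⟩
  · rw [edist_dist, edist_dist]
    refine ENNReal.ofReal_le_ofReal ?_
    rw [Metric.mem_closedBall, not_le] at hzB
    rw [Metric.mem_closedBall] at hxB
    rw [dist_comm u x, dist_comm u z]
    exact hxB.trans hzB.le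

/-- A closed disc as a bounded Borel set. -/
def closedDisc (u : Plane) (r : ℝ) : BoundedBorel :=
  ⟨Metric.closedBall u r, measurableSet_closedBall, Metric.isBounded_closedBall⟩

/-- The distance to the nearest point, as a function of the counts. -/
noncomputable def distOfCounts (u : Plane) (f : BoundedBorel → ℕ) : ℝ≥0∞ :=
  ⨅ q : ℚ, if f (closedDisc u q) = 0 then ⊤ else ENNReal.ofReal q

theorem measurable_distOfCounts (u : Plane) : Measurable (distOfCounts u) := by
  refine Measurable.iInf fun q => Measurable.ite ?_ measurable_const measurable_const
  exact measurable_pi_apply (closedDisc u q) (measurableSet_singleton 0)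

section Nearest

variable {Ω : Type*} [MeasurableSpace Ω] {μ : Measure Ω} {lam : ℝ} {Φ : Ω → Set Plane}

theorem IsHPPP.pointCount_eq_zero_iff (hΦ : IsHPPP μ lam Φ) (B : BoundedBorel) (ω : Ω) :
    pointCount Φ B.1 ω = 0 ↔ Φ ω ∩ B.1 = ∅ :=
  Set.ncard_eq_zero (hΦ.locallyFinite ω B.1 B.2.2)

/-- Rational radii suffice by density; a negative radius gives an empty disc, hence the value `⊤`.
Expressing the distance through countably many counts yields its measurability and lets independence
of the counts pass to distances. -/
theorem IsHPPP.infEDist_eq (hΦ : IsHPPP μ lam Φ) (u : Plane) (ω : Ω) :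
    Metric.infEDist u (Φ ω) = distOfCounts u (fun B => pointCount Φ B.1 ω) := by
  refine le_antisymm (le_iInf fun q => ?_) ?_
  · split_ifs with h
    · exact le_top
    · rw [hΦ.pointCount_eq_zero_iff] at h
      obtain ⟨x, hx, hxB⟩ := Set.nonempty_iff_ne_empty.2 h
      refine (Metric.infEDist_le_edist_of_mem hx).trans ?_
      rw [edist_comm, edist_dist]
      exact ENNReal.ofReal_le_ofReal hxB
  · refine Metric.le_infEDist.2 fun x hx => le_of_forall_gt fun t ht => ?_
    obtain ⟨q, hq, hqt⟩ := ENNReal.lt_iff_exists_rat_btwn.1 ht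
    refine lt_of_le_of_lt ((iInf_le _ q).trans (le_of_eq (if_neg ?_))) hqt.2
    rw [hΦ.pointCount_eq_zero_iff, ← Ne, ← Set.nonempty_iff_ne_empty]
    refine ⟨x, hx, ?_⟩
    have := hqt.1
    rw [edist_dist] at this
    have := (ENNReal.ofReal_lt_ofReal_iff_of_nonneg dist_nonneg).1 this
    exact Metric.mem_closedBall'.2 this.le

theorem IsHPPP.measurable_counts (hΦ : IsHPPP μ lam Φ) :
    Measurable fun ω (B : BoundedBorel) => pointCount Φ B.1 ω :=
  measurable_pi_lambda _ hΦ.measurable_count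

theorem IsHPPP.measurable_infEDist (hΦ : IsHPPP μ lam Φ) (u : Plane) :
    Measurable fun ω => Metric.infEDist u (Φ ω) := by
  simp_rw [hΦ.infEDist_eq u]
  exact (measurable_distOfCounts u).comp hΦ.measurable_counts

theorem IsHPPP.infEDist_gt_iff (hΦ : IsHPPP μ lam Φ) (u : Plane) {r : ℝ} (hr : 0 ≤ r) (ω : Ω) :
    ENNReal.ofReal r < Metric.infEDist u (Φ ω) ↔ pointCount Φ (closedDisc u r).1 ω = 0 := by
  rw [hΦ.pointCount_eq_zero_iff, ← not_le, ← not_iff_not, not_not, ← Ne,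
    ← Set.nonempty_iff_ne_empty]
  constructor
  · intro h
    have hne : (Φ ω).Nonempty := by
      by_contra h0
      rw [Set.not_nonempty_iff_eq_empty.1 h0] at h
      simp at h
    obtain ⟨x, hx, hxe⟩ := exists_infEDist_eq_edist (hΦ.locallyFinite ω) hne u
    rw [hxe, edist_dist, ENNReal.ofReal_le_ofReal_iff hr] at h
    exact ⟨x, hx, Metric.mem_closedBall'.2 h⟩
  · rintro ⟨x, hx, hxB⟩
    refine (Metric.infEDist_le_edist_of_mem hx).trans ?_
    rw [edist_dist]
    exact ENNReal.ofReal_le_ofReal (Metric.mem_closedBall'.1 hxB)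

/-- The void probability of a disc. -/
theorem IsHPPP.measure_infEDist_gt (hΦ : IsHPPP μ lam Φ) (hlam : 0 ≤ lam) (u : Plane) {r : ℝ}
    (hr : 0 ≤ r) :
    μ {ω | ENNReal.ofReal r < Metric.infEDist u (Φ ω)} =
      ENNReal.ofReal (Real.exp (-(Real.pi * lam * r ^ 2))) := by
  have hset : {ω | ENNReal.ofReal r < Metric.infEDist u (Φ ω)} =
      pointCount Φ (closedDisc u r).1 ⁻¹' {0} := by
    ext ω
    exact hΦ.infEDist_gt_iff u hr ω
  rw [hset, ← Measure.map_apply (hΦ.measurable_count _) (measurableSet_singleton 0),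
    hΦ.law_count, poissonMeasure_singleton]
  have hvol : volume.real (closedDisc u r).1 = r ^ 2 * Real.pi := by
    change volume.real (Metric.closedBall u r) = _
    rw [measureReal_def, EuclideanSpace.volume_closedBall_fin_two]
    simp [ENNReal.toReal_ofReal hr, Real.pi_pos.le]
  have hcoe : (((lam * volume.real (closedDisc u r).1).toNNReal : ℝ≥0) : ℝ) =
      Real.pi * lam * r ^ 2 := by
    rw [Real.coe_toNNReal _ (mul_nonneg hlam measureReal_nonneg), hvol]
    ring
  rw [hcoe]
  simp

/-- An empty configuration misses every disc of radius $n$, and these void probabilities tend to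
$0$. This rules out the default value `0` of `Metric.infDist` on the empty set. -/
theorem IsHPPP.ae_nonempty (hΦ : IsHPPP μ lam Φ) (hlam : 0 < lam) : ∀ᵐ ω ∂μ, (Φ ω).Nonempty := by
  have hle : ∀ n : ℕ, μ {ω | ¬ (Φ ω).Nonempty} ≤
      ENNReal.ofReal (Real.exp (-(Real.pi * lam * (n : ℝ) ^ 2))) := fun n => by
    rw [← hΦ.measure_infEDist_gt hlam.le 0 n.cast_nonneg]
    refine measure_mono fun ω hω => ?_
    have : Φ ω = ∅ := Set.not_nonempty_iff_eq_empty.1 hω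
    simp [this]
  have hlim : Filter.Tendsto
      (fun n : ℕ => ENNReal.ofReal (Real.exp (-(Real.pi * lam * (n : ℝ) ^ 2))))
      Filter.atTop (nhds 0) := by
    rw [← ENNReal.ofReal_zero]
    refine ENNReal.tendsto_ofReal (Real.tendsto_exp_neg_atTop_nhds_zero.comp ?_)
    exact ((Filter.tendsto_pow_atTop two_ne_zero).comp
      tendsto_natCast_atTop_atTop).const_mul_atTop (mul_pos Real.pi_pos hlam)
  exact le_antisymm (ge_of_tendsto' hlim hle) bot_le

theorem IsHPPP.measurable_infDist_sq (hΦ : IsHPPP μ lam Φ) (u : Plane) :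
    Measurable fun ω => Metric.infDist u (Φ ω) ^ 2 :=
  (hΦ.measurable_infEDist u).ennreal_toReal.pow_const 2

/-- The squared distance to the nearest point is exponentially distributed. -/
theorem IsHPPP.map_infDist_sq [IsProbabilityMeasure μ] (hΦ : IsHPPP μ lam Φ) (hlam : 0 < lam)
    (u : Plane) :
    μ.map (fun ω => Metric.infDist u (Φ ω) ^ 2) = expMeasure (Real.pi * lam) := by
  have hb : 0 < Real.pi * lam := mul_pos Real.pi_pos hlam
  have := isProbabilityMeasure_expMeasure hb
  have := Measure.isProbabilityMeasure_map (μ := μ) (hΦ.measurable_infDist_sq u).aemeasurable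
  have key : ∀ t : ℝ, 0 ≤ t → μ.map (fun ω => Metric.infDist u (Φ ω) ^ 2) (Set.Iic t) =
      expMeasure (Real.pi * lam) (Set.Iic t) := by
    intro t ht
    rw [← Set.compl_Ioi, prob_compl_eq_one_sub measurableSet_Ioi,
      prob_compl_eq_one_sub measurableSet_Ioi, expMeasure_Ioi hb ht,
      Measure.map_apply (hΦ.measurable_infDist_sq u) measurableSet_Ioi]
    congr 1
    have h := hΦ.measure_infEDist_gt hlam.le u (Real.sqrt_nonneg t)
    rw [Real.sq_sqrt ht] at h
    rw [← h]
    refine measure_congr ?_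
    filter_upwards [hΦ.ae_nonempty hlam] with ω hω
    refine propext ?_
    change t < Metric.infDist u (Φ ω) ^ 2 ↔ ENNReal.ofReal √t < Metric.infEDist u (Φ ω)
    rw [ENNReal.ofReal_lt_iff_lt_toReal (Real.sqrt_nonneg t) (Metric.infEDist_ne_top hω)]
    rw [← Real.sqrt_lt_sqrt_iff ht, Real.sqrt_sq Metric.infDist_nonneg]
    rfl
  refine Measure.eq_of_cdf _ _ (StieltjesFunction.ext fun t => ?_)
  rw [cdf_eq_real, cdf_eq_real, measureReal_def, measureReal_def]
  congr 1
  rcases le_or_gt 0 t with ht | ht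
  · exact key t ht
  -- Below zero both distribution functions vanish, by monotonicity from the case $t=0$.
  · have h0 : expMeasure (Real.pi * lam) (Set.Iic 0) = 0 := by
      rw [expMeasure_Iic hb le_rfl]
      simp
    have hsub : Set.Iic t ⊆ Set.Iic 0 := Set.Iic_subset_Iic.2 ht.le
    rw [measure_mono_null hsub h0, measure_mono_null hsub ((key 0 le_rfl).trans h0)]

/-- Excludes a station at the user itself, where the received power is `⊤` but the real power of `0`
takes a default value. -/
theorem IsHPPP.ae_infDist_pos [IsProbabilityMeasure μ] (hΦ : IsHPPP μ lam Φ) (hlam : 0 < lam)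
    (u : Plane) : ∀ᵐ ω ∂μ, 0 < Metric.infDist u (Φ ω) := by
  have h := congrFun (congrArg DFunLike.coe (hΦ.map_infDist_sq hlam u)) (Set.Iic 0)
  rw [expMeasure_Iic (mul_pos Real.pi_pos hlam) le_rfl,
    Measure.map_apply (hΦ.measurable_infDist_sq u) measurableSet_Iic] at h
  have h' : ∀ᵐ ω ∂μ, ¬ Metric.infDist u (Φ ω) ^ 2 ≤ 0 := by
    rw [ae_iff]
    simp only [not_not]
    exact h.trans (by simp)
  filter_upwards [h'] with ω hω
  exact lt_of_le_of_ne Metric.infDist_nonneg fun h0 => hω (by simp [← h0])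

theorem map_infDist_sq_prod [IsProbabilityMeasure μ] {lam' : ℝ} {Ψ : Ω → Set Plane}
    (hΦ : IsHPPP μ lam Φ) (hΨ : IsHPPP μ lam' Ψ) (hlam : 0 < lam) (hlam' : 0 < lam')
    (hindep : IndepPointProcesses μ Φ Ψ) (u : Plane) :
    μ.map (fun ω => (Metric.infDist u (Φ ω) ^ 2, Metric.infDist u (Ψ ω) ^ 2)) =
      (expMeasure (Real.pi * lam)).prod (expMeasure (Real.pi * lam')) := by
  rw [← hΦ.map_infDist_sq hlam u, ← hΨ.map_infDist_sq hlam' u]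
  refine (indepFun_iff_map_prod_eq_prod_map_map (hΦ.measurable_infDist_sq u).aemeasurable
    (hΨ.measurable_infDist_sq u).aemeasurable).1 ?_
  have hg : Measurable fun f => (distOfCounts u f).toReal ^ 2 :=
    (measurable_distOfCounts u).ennreal_toReal.pow_const 2
  have h := IndepFun.comp hindep hg hg
  have e : ∀ {l : ℝ} {Θ : Ω → Set Plane}, IsHPPP μ l Θ →
      (fun ω => Metric.infDist u (Θ ω) ^ 2) = (fun f => (distOfCounts u f).toReal ^ 2) ∘
        fun ω (B : BoundedBorel) => pointCount Θ B.1 ω := by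
    intro l Θ hΘ
    funext ω
    simp only [Function.comp_apply, ← hΘ.infEDist_eq u ω]
    rfl
  rwa [← e hΦ, ← e hΨ] at h

end Nearest

/-! ### The association rule in terms of nearest distances -/

theorem isAttracted_iff {S : Set Plane} (hS : ∀ B, Bornology.IsBounded B → (S ∩ B).Finite)
    {rc raMax : ℝ} (hrc : 0 ≤ rc) (hra : 0 ≤ raMax) {L : BatteryLevel} (hL : IsLowBattery L)
    (u : Plane) :
    IsAttracted rc raMax L u S ↔ Metric.infEDist u S ≤ ENNReal.ofReal (rc + raMax) := by
  have hiff : ∀ x, attractionDistance rc u x ≤ raMax ↔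
      edist u x ≤ ENNReal.ofReal (rc + raMax) := fun x => by
    rw [attractionDistance, max_le_iff, edist_dist, ENNReal.ofReal_le_ofReal_iff (by positivity)]
    exact ⟨fun h => by linarith [h.1], fun h => ⟨by linarith, hra⟩⟩
  constructor
  · rintro ⟨-, x, hx, -, hd⟩
    exact (Metric.infEDist_le_edist_of_mem hx).trans ((hiff x).1 hd)
  · intro h
    have hne : S.Nonempty := by
      by_contra h0
      rw [Set.not_nonempty_iff_eq_empty.1 h0] at h
      simp at h
    obtain ⟨x, hx, hxe⟩ := exists_infEDist_eq_edist hS hne u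
    refine ⟨Or.inr hL, x, hx, fun y hy => ?_, (hiff x).2 (hxe ▸ h)⟩
    have := Metric.infEDist_le_edist_of_mem (x := u) hy
    rw [hxe, edist_dist, edist_dist, ENNReal.ofReal_le_ofReal_iff dist_nonneg] at this
    exact this

theorem not_isAttracted_of_isHighBattery {L : BatteryLevel} (hL : IsHighBattery L)
    (rc raMax : ℝ) (u : Plane) (S : Set Plane) : ¬ IsAttracted rc raMax L u S := by
  rintro ⟨h, -⟩
  rcases hL with rfl | rfl <;> revert h <;> decide

/-- Only the nearest station of each tier matters for the strongest received power. -/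
theorem strongestFrom_iff {P : Fin 2 → ℝ} {α : ℝ} (hα : 0 < α) (u : Plane)
    {S : Fin 2 → Set Plane} (hS : ∀ k B, Bornology.IsBounded B → (S k ∩ B).Finite) (k : Fin 2) :
    StrongestFrom P α u S k ↔ (Metric.infEDist u (S k) < ⊤ ∧ ∀ j,
      ENNReal.ofReal (P j) * Metric.infEDist u (S j) ^ (-α) ≤
        ENNReal.ofReal (P k) * Metric.infEDist u (S k) ^ (-α)) := by
  have hanti : ∀ p : ℝ≥0∞, ∀ {a b : ℝ≥0∞}, a ≤ b → p * b ^ (-α) ≤ p * a ^ (-α) := by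
    intro p a b hab
    rw [ENNReal.rpow_neg, ENNReal.rpow_neg]
    gcongr
  constructor
  · rintro ⟨x, hx, hmax⟩
    refine ⟨(Metric.infEDist_le_edist_of_mem hx).trans_lt (edist_lt_top u x), fun j => ?_⟩
    refine le_trans ?_ (hanti _ (Metric.infEDist_le_edist_of_mem hx))
    rcases (S j).eq_empty_or_nonempty with h | h
    -- An empty tier is at distance `⊤` and so contributes zero power.
    · simp [h, ENNReal.top_rpow_of_neg (neg_lt_zero.2 hα)]
    · obtain ⟨y, hy, hye⟩ := exists_infEDist_eq_edist (hS j) h u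
      rw [hye]
      exact hmax j y hy
  · rintro ⟨hfin, hmax⟩
    have hne : (S k).Nonempty := by
      by_contra h0
      rw [Set.not_nonempty_iff_eq_empty.1 h0] at hfin
      simp at hfin
    obtain ⟨x, hx, hxe⟩ := exists_infEDist_eq_edist (hS k) hne u
    refine ⟨x, hx, fun j y hy => (hanti _ (Metric.infEDist_le_edist_of_mem hy)).trans ?_⟩
    rw [receivedPower, ← hxe]
    exact hmax j

/-- Raising to the power $2/\alpha$ is monotone and turns path loss into squared distances, whose
laws are exponential. -/
theorem mul_rpow_neg_le_iff {p q α a b : ℝ} (hp : 0 < p) (hq : 0 < q) (hα : 0 < α) (ha : 0 < a)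
    (hb : 0 < b) : p * a ^ (-α) ≤ q * b ^ (-α) ↔ (p / q) ^ (2 / α) * b ^ 2 ≤ a ^ 2 := by
  have h2 : ∀ {x : ℝ}, 0 < x → x ^ 2 = (x ^ α) ^ (2 / α) := fun {x} hx => by
    rw [← Real.rpow_mul hx.le, mul_div_cancel₀ _ hα.ne', Real.rpow_two]
  have haα := Real.rpow_pos_of_pos ha α
  have hbα := Real.rpow_pos_of_pos hb α
  rw [h2 ha, h2 hb, ← Real.mul_rpow (by positivity) hbα.le,
    Real.rpow_le_rpow_iff (by positivity) haα.le (by positivity), Real.rpow_neg ha.le,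
    Real.rpow_neg hb.le, ← div_eq_mul_inv, ← div_eq_mul_inv, div_le_div_iff₀ haα hbα,
    div_mul_eq_mul_div, div_le_iff₀ hq, mul_comm q]

theorem strongestFrom_iff_infDist {P : Fin 2 → ℝ} (hP : ∀ k, 0 < P k) {α : ℝ} (hα : 0 < α)
    (u : Plane) {S : Fin 2 → Set Plane} (hS : ∀ k B, Bornology.IsBounded B → (S k ∩ B).Finite)
    (hne : ∀ k, (S k).Nonempty) (hpos : ∀ k, 0 < Metric.infDist u (S k)) {k j : Fin 2}
    (hkj : k ≠ j) :
    StrongestFrom P α u S k ↔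
      (P j / P k) ^ (2 / α) * Metric.infDist u (S k) ^ 2 ≤ Metric.infDist u (S j) ^ 2 := by
  have hE : ∀ i, ENNReal.ofReal (P i) * Metric.infEDist u (S i) ^ (-α) =
      ENNReal.ofReal (P i * Metric.infDist u (S i) ^ (-α)) := fun i => by
    rw [ENNReal.ofReal_mul (hP i).le, ← ENNReal.ofReal_rpow_of_pos (hpos i), Metric.infDist,
      ENNReal.ofReal_toReal (Metric.infEDist_ne_top (hne i))]
  have hk := hpos k
  rw [strongestFrom_iff hα u hS, ← mul_rpow_neg_le_iff (hP j) (hP k) hα (hpos j) hk]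
  simp only [hE]
  have hnn : 0 ≤ P k * Metric.infDist u (S k) ^ (-α) :=
    mul_nonneg (hP k).le (Real.rpow_nonneg hk.le _)
  refine ⟨fun h => (ENNReal.ofReal_le_ofReal_iff hnn).1 (h.2 j), fun h =>
    ⟨(Metric.infEDist_ne_top (hne k)).lt_top, fun i => ?_⟩⟩
  have hi : i = k ∨ i = j := by omega
  rcases hi with rfl | rfl
  · exact le_rfl
  · exact ENNReal.ofReal_le_ofReal h

theorem highFormula_eq {lam P : Fin 2 → ℝ} (hP : ∀ k, 0 < P k) (α : ℝ)
    {k j : Fin 2} (hkj : k ≠ j) :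
    highFormula lam P α k = lam k / (lam k + lam j * (P j / P k) ^ (2 / α)) := by
  have hsum : ∑ i, lam i * (P i / P k) ^ (2 / α) = lam k + lam j * (P j / P k) ^ (2 / α) := by
    have hu : (Finset.univ : Finset (Fin 2)) = {k, j} := by
      ext i
      simp only [Finset.mem_univ, Finset.mem_insert, Finset.mem_singleton, true_iff]
      omega
    rw [hu, Finset.sum_pair hkj, div_self (hP k).ne', Real.one_rpow, mul_one]
  rw [highFormula, hsum, mul_inv, inv_inv]
  rfl

/-! ### Association probabilities -/

section Association

variable {Ω : Type*} [MeasurableSpace Ω] {μ : Measure Ω} {lam P : Fin 2 → ℝ} {α : ℝ}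
  {Φ : Fin 2 → Ω → Set Plane}

theorem measurableSet_strongestFrom (hα : 0 < α) (hΦ : ∀ k, IsHPPP μ (lam k) (Φ k)) (u : Plane)
    (k : Fin 2) : MeasurableSet {ω | StrongestFrom P α u (fun j => Φ j ω) k} := by
  have hset : {ω | StrongestFrom P α u (fun j => Φ j ω) k} =
      {ω | Metric.infEDist u (Φ k ω) < ⊤} ∩
        ⋂ j, {ω | ENNReal.ofReal (P j) * Metric.infEDist u (Φ j ω) ^ (-α) ≤
          ENNReal.ofReal (P k) * Metric.infEDist u (Φ k ω) ^ (-α)} := by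
    ext ω
    simp only [Set.mem_ofPred_eq, Set.mem_inter_iff, Set.mem_iInter]
    exact strongestFrom_iff hα u (fun j => (hΦ j).locallyFinite ω) k
  have hm := fun j => (hΦ j).measurable_infEDist u
  rw [hset]
  exact (measurableSet_lt (hm k) measurable_const).inter (MeasurableSet.iInter fun j =>
    measurableSet_le (((hm j).pow_const _).const_mul _) (((hm k).pow_const _).const_mul _))

theorem indepPointProcesses_of_ne (hindep : IndepPointProcesses μ (Φ 0) (Φ 1)) {k j : Fin 2}
    (hkj : k ≠ j) : IndepPointProcesses μ (Φ k) (Φ j) := by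
  have h : (k = 0 ∧ j = 1) ∨ (k = 1 ∧ j = 0) := by omega
  rcases h with ⟨rfl, rfl⟩ | ⟨rfl, rfl⟩
  · exact hindep
  · exact IndepFun.symm hindep

theorem tail_formula_eq (hlam : ∀ k, 0 < lam k) (hP : ∀ k, 0 < P k) {k j : Fin 2} (hkj : k ≠ j)
    (r : ℝ) :
    Real.pi * lam k / (Real.pi * lam k + Real.pi * lam j * (P j / P k) ^ (2 / α)) *
        Real.exp (-((Real.pi * lam k + Real.pi * lam j * (P j / P k) ^ (2 / α)) * r ^ 2)) =
      highFormula lam P α k *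
        Real.exp (-(Real.pi * (lam k / highFormula lam P α k) * r ^ 2)) := by
  have hk := hlam k
  have hπ := Real.pi_pos
  rw [highFormula_eq hP α hkj, div_div_cancel₀ hk.ne', mul_assoc Real.pi, ← mul_add,
    mul_div_mul_left _ _ hπ.ne']

variable [IsProbabilityMeasure μ]

theorem ae_forall_nonempty_and_infDist_pos (hlam : ∀ k, 0 < lam k)
    (hΦ : ∀ k, IsHPPP μ (lam k) (Φ k)) (u : Plane) :
    ∀ᵐ ω ∂μ, ∀ k, (Φ k ω).Nonempty ∧ 0 < Metric.infDist u (Φ k ω) := by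
  rw [ae_all_iff]
  intro k
  filter_upwards [(hΦ k).ae_nonempty (hlam k), (hΦ k).ae_infDist_pos (hlam k) u] with ω h1 h2
  exact ⟨h1, h2⟩

theorem measureReal_far_and_strongestFrom (hlam : ∀ k, 0 < lam k) (hP : ∀ k, 0 < P k)
    (hα : 0 < α) (hΦ : ∀ k, IsHPPP μ (lam k) (Φ k)) (hindep : IndepPointProcesses μ (Φ 0) (Φ 1))
    (u : Plane) {k j : Fin 2} (hkj : k ≠ j) {r : ℝ} (hr : 0 ≤ r) :
    μ.real {ω | ENNReal.ofReal r < Metric.infEDist u (Φ k ω) ∧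
        StrongestFrom P α u (fun i => Φ i ω) k} =
      highFormula lam P α k *
        Real.exp (-(Real.pi * (lam k / highFormula lam P α k) * r ^ 2)) := by
  have hπ := Real.pi_pos
  have hk := hlam k
  have hj := hlam j
  have hc : 0 < (P j / P k) ^ (2 / α) := Real.rpow_pos_of_pos (div_pos (hP j) (hP k)) _
  have hprod := expMeasure_prod_le (mul_pos hπ hk) (mul_pos hπ hj) hc.le (sq_nonneg r)
  have hm : MeasurableSet {p : ℝ × ℝ | r ^ 2 < p.1 ∧ (P j / P k) ^ (2 / α) * p.1 ≤ p.2} :=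
    (measurableSet_lt measurable_const measurable_fst).inter
      (measurableSet_le (measurable_fst.const_mul _) measurable_snd)
  rw [← map_infDist_sq_prod (hΦ k) (hΦ j) hk hj (indepPointProcesses_of_ne hindep hkj) u,
    Measure.map_apply (((hΦ k).measurable_infDist_sq u).prodMk ((hΦ j).measurable_infDist_sq u))
      hm] at hprod
  rw [← tail_formula_eq hlam hP hkj, measureReal_def, ← ENNReal.toReal_ofReal (r := _ / _ * _)
    (by positivity), ← hprod]
  congr 1
  refine measure_congr ?_
  filter_upwards [ae_forall_nonempty_and_infDist_pos hlam hΦ u] with ω hω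
  refine propext (and_congr ?_ ?_)
  · rw [ENNReal.ofReal_lt_iff_lt_toReal hr (Metric.infEDist_ne_top (hω k).1)]
    exact (sq_lt_sq₀ hr Metric.infDist_nonneg).symm
  · exact strongestFrom_iff_infDist hP hα u (fun i => (hΦ i).locallyFinite ω)
      (fun i => (hω i).1) (fun i => (hω i).2) hkj

/-- Up to a null set, failure of tier $j$ is the strict form of the comparison that makes tier $k$
strongest, so the value is unchanged. This serves the macro tier, whose event also involves the
distance to the small cells. -/
theorem measureReal_far_and_not_strongestFrom (hlam : ∀ k, 0 < lam k) (hP : ∀ k, 0 < P k)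
    (hα : 0 < α) (hΦ : ∀ k, IsHPPP μ (lam k) (Φ k)) (hindep : IndepPointProcesses μ (Φ 0) (Φ 1))
    (u : Plane) {k j : Fin 2} (hkj : k ≠ j) {r : ℝ} (hr : 0 ≤ r) :
    μ.real {ω | ENNReal.ofReal r < Metric.infEDist u (Φ k ω) ∧
        ¬ StrongestFrom P α u (fun i => Φ i ω) j} =
      highFormula lam P α k *
        Real.exp (-(Real.pi * (lam k / highFormula lam P α k) * r ^ 2)) := by
  have hπ := Real.pi_pos
  have hk := hlam k
  have hj := hlam j
  have hc : 0 < (P j / P k) ^ (2 / α) := Real.rpow_pos_of_pos (div_pos (hP j) (hP k)) _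
  have hprod := expMeasure_prod_lt (mul_pos hπ hk) (mul_pos hπ hj) hc.le (sq_nonneg r)
  have hm : MeasurableSet {p : ℝ × ℝ | r ^ 2 < p.1 ∧ (P j / P k) ^ (2 / α) * p.1 < p.2} :=
    (measurableSet_lt measurable_const measurable_fst).inter
      (measurableSet_lt (measurable_fst.const_mul _) measurable_snd)
  rw [← map_infDist_sq_prod (hΦ k) (hΦ j) hk hj (indepPointProcesses_of_ne hindep hkj) u,
    Measure.map_apply (((hΦ k).measurable_infDist_sq u).prodMk ((hΦ j).measurable_infDist_sq u))
      hm] at hprod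
  rw [← tail_formula_eq hlam hP hkj, measureReal_def, ← ENNReal.toReal_ofReal (r := _ / _ * _)
    (by positivity), ← hprod]
  congr 1
  refine measure_congr ?_
  filter_upwards [ae_forall_nonempty_and_infDist_pos hlam hΦ u] with ω hω
  refine propext (and_congr ?_ ?_)
  · rw [ENNReal.ofReal_lt_iff_lt_toReal hr (Metric.infEDist_ne_top (hω k).1)]
    exact (sq_lt_sq₀ hr Metric.infDist_nonneg).symm
  -- Negating the criterion for $j$ yields the constant $(P_k/P_j)^{2/\alpha}$, the inverse of the
  -- one for $k$.
  · rw [strongestFrom_iff_infDist hP hα u (fun i => (hΦ i).locallyFinite ω)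
      (fun i => (hω i).1) (fun i => (hω i).2) hkj.symm, not_le, ← inv_div (P j) (P k),
      Real.inv_rpow (div_pos (hP j) (hP k)).le, lt_inv_mul_iff₀ hc]

theorem measureReal_strongestFrom (hlam : ∀ k, 0 < lam k) (hP : ∀ k, 0 < P k)
    (hα : 0 < α) (hΦ : ∀ k, IsHPPP μ (lam k) (Φ k)) (hindep : IndepPointProcesses μ (Φ 0) (Φ 1))
    (u : Plane) (k : Fin 2) :
    μ.real {ω | StrongestFrom P α u (fun i => Φ i ω) k} = highFormula lam P α k := by
  obtain ⟨j, hkj⟩ : ∃ j, k ≠ j := (exists_ne k).imp fun _ h => h.symm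
  -- Radius $0$ makes the distance condition almost surely vacuous.
  have h := measureReal_far_and_strongestFrom hlam hP hα hΦ hindep u hkj le_rfl
  simp only [ne_eq, OfNat.ofNat_ne_zero, not_false_eq_true, zero_pow, mul_zero, neg_zero,
    Real.exp_zero, mul_one] at h
  rw [← h]
  refine measureReal_congr ?_
  filter_upwards [ae_forall_nonempty_and_infDist_pos hlam hΦ u] with ω hω
  refine propext (iff_and_self.2 fun _ => ?_)
  rw [ENNReal.ofReal_zero]
  exact (ENNReal.toReal_pos_iff.1 (hω k).2).1

end Association

theorem lemma1 {Ω : Type*} [MeasurableSpace Ω] (μ : Measure Ω) [IsProbabilityMeasure μ]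
    (lam P : Fin 2 → ℝ) (hlam : ∀ k, 0 < lam k) (hP : ∀ k, 0 < P k)
    (α : ℝ) (hα : 2 < α) (rc raMax : ℝ) (hrc : 0 ≤ rc) (hra : 0 ≤ raMax)
    (Φ : Fin 2 → Ω → Set Plane) (hΦ : ∀ k, IsHPPP μ (lam k) (Φ k))
    (hindep : IndepPointProcesses μ (Φ 0) (Φ 1))
    (u : Plane) (k : Fin 2) :
    (∀ L : BatteryLevel, IsHighBattery L →
      MeasurableSet (associationEvent Φ P α rc raMax L u k) ∧
      μ.real (associationEvent Φ P α rc raMax L u k) = highFormula lam P α k) ∧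
    (∀ L : BatteryLevel, IsLowBattery L → ∀ rs : ℝ, rs = rc + raMax →
      MeasurableSet (associationEvent Φ P α rc raMax L u k) ∧
      μ.real (associationEvent Φ P α rc raMax L u k) =
        (-1) ^ tierNumber k *
            (highFormula lam P α 1 *
                Real.exp (-(Real.pi * (lam 1 / highFormula lam P α 1) * rs ^ 2)) -
              Real.exp (-(Real.pi * lam 1 * rs ^ 2))) +
          ((tierNumber k : ℝ) - 1)) := by
  have hα0 : 0 < α := by linarith
  refine ⟨fun L hL => ?_, fun L hL rs hrs => ?_⟩
  · have hset : associationEvent Φ P α rc raMax L u k =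
        {ω | StrongestFrom P α u (fun i => Φ i ω) k} := by
      ext ω
      simp [associationEvent, AssociatesWith, not_isAttracted_of_isHighBattery hL]
    rw [hset]
    exact ⟨measurableSet_strongestFrom hα0 hΦ u k,
      measureReal_strongestFrom hlam hP hα0 hΦ hindep u k⟩
  · have hrs0 : 0 ≤ rs := hrs ▸ add_nonneg hrc hra
    set far := {ω | ENNReal.ofReal rs < Metric.infEDist u (Φ 1 ω)} with hfar
    have hfarm : MeasurableSet far :=
      measurableSet_lt measurable_const ((hΦ 1).measurable_infEDist u)
    have hattr : ∀ ω, IsAttracted rc raMax L u (Φ 1 ω) ↔ ω ∉ far := fun ω => by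
      rw [isAttracted_iff ((hΦ 1).locallyFinite ω) hrc hra hL, ← hrs]
      exact not_lt.symm
    have hfarp : μ.real far = Real.exp (-(Real.pi * lam 1 * rs ^ 2)) := by
      rw [measureReal_def, (hΦ 1).measure_infEDist_gt (hlam 1).le u hrs0,
        ENNReal.toReal_ofReal (Real.exp_pos _).le]
    have hst := fun i => measurableSet_strongestFrom (P := P) hα0 hΦ u i
    fin_cases k
    · have hset : associationEvent Φ P α rc raMax L u 0 =
          far ∩ {ω | StrongestFrom P α u (fun i => Φ i ω) 0} := by
        ext ω
        simp [associationEvent, AssociatesWith, hattr]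
      -- Macro association is computed as the probability of `far` minus that of `far` without a
      -- strongest macro station.
      have hdiff := measureReal_inter_add_sdiff (μ := μ) (s := far) (hst 0)
      have hns : μ.real (far \ {ω | StrongestFrom P α u (fun i => Φ i ω) 0}) = _ :=
        measureReal_far_and_not_strongestFrom hlam hP hα0 hΦ hindep u
          (zero_ne_one (α := Fin 2)).symm hrs0
      refine ⟨hset ▸ hfarm.inter (hst 0), ?_⟩
      change μ.real (associationEvent Φ P α rc raMax L u 0) = _
      rw [hset]
      simp only [tierNumber]
      norm_num
      linarith
    -- A small cell is chosen either by attraction or, failing that, by power: a disjoint union.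
    · have hset : associationEvent Φ P α rc raMax L u 1 =
          farᶜ ∪ (far ∩ {ω | StrongestFrom P α u (fun i => Φ i ω) 1}) := by
        ext ω
        simp [associationEvent, AssociatesWith, hattr]
      have hs : μ.real (far ∩ {ω | StrongestFrom P α u (fun i => Φ i ω) 1}) = _ :=
        measureReal_far_and_strongestFrom hlam hP hα0 hΦ hindep u
          (zero_ne_one (α := Fin 2)).symm hrs0
      refine ⟨hset ▸ hfarm.compl.union (hfarm.inter (hst 1)), ?_⟩
      change μ.real (associationEvent Φ P α rc raMax L u 1) = _
      rw [hset, measureReal_union (disjoint_compl_left.mono_right Set.inter_subset_left)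
        (hfarm.inter (hst 1)), hs, probReal_compl_eq_one_sub hfarm, hfarp]
      simp only [tierNumber]
      norm_num
      ring
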